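/- **Theorem (spectrum of the edge lamplighter random walk on the cycle $C_n$).** Let $n\ge 3$, let $C_n$ be the cycle graph with $n$ vertices and let $E_n$ be its set of $n$ edges. The edge lamplighter graph $\mathcal{L}(E_n)$ has vertex set $\{0,1\}^{E_n}\times C_n$, and $(\omega,x)$, $(\theta,y)$ are adjacent when $x\sim y$ in $C_n$ and $\omega(e)=\theta(e)$ for every edge $e\in E_n$ with $e\neq\{x,y\}$. The edge lamplighter random walk on $C_n$ is the simple random walk on this graph; its Markov operator $(\mathcal{M}f)(v)=\frac{1}{\deg v}\sum_{u\sim v}f(u)$ acts on the complex functions on $\mathcal{L}(E_n)$. The multiplicity of a number as an eigenvalue of $\mathcal{M}$ is the dimension of its eigenspace ($0$ if it is not an eigenvalue). Then the spectrum of $\mathcal{M}$ is $$\{1\}\cup\{0\}\cup\Big\{\cos\tfrac{h\pi}{k}:\ 3\le k\le n+1,\ 1\le h\le k-1,\ \gcd(h,k)=1\Big\}$$ when $n$ is odd, and $$\{1\}\cup\{0\}\cup\{-1\}\cup\Big\{\cos\tfrac{h\pi}{k}:\ 3\le k\le n+1,\ 1\le h\le k-1,\ \gcd(h,k)=1\Big\}$$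 when $n$ is even. Moreover, the multiplicities of the eigenvalues are the following. 1. Let $3\le k\le n+1$, $1\le h\le k-1$, $\gcd(h,k)=1$, and write $n+1=kq+r$ with $0\le r\le k-1$. The multiplicity of $\cos\frac{h\pi}{k}$ is - $n\,\dfrac{2^n-2^{r-1}}{2^k-1}$ if $r\ne 0,1$; - $n\,\dfrac{2^n-1}{2^k-1}$ if $r=1$ and $hq$ is odd; - $n\,\dfrac{2^n-1}{2^k-1}+2$ if $r=1$ and $hq$ is even; - $n\,\dfrac{2^n+2^{k-1}-1}{2^k-1}$ if $r=0$. 2. The multiplicity of $1$ is $1$. The multiplicity of $-1$ is $1$ if $n$ is even and $0$ if $n$ is odd. 3. The multiplicity of $0$ is - $\frac{n}{3}2^n+\frac{n}{3}$ if $n$ is odd; - $\frac{n}{3}2^n-\frac{n}{3}$ if $n\equiv 2 \pmod 4$; - $\frac{n}{3}2^n-\frac{n}{3}+2$ if $n\equiv 0 \pmod 4$. -/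

import Mathlib

noncomputable section

open Classical in
/-- The Markov operator of the simple random walk on a finite graph `G`:
`(M f)(x) = (1 / deg x) * ∑ y ~ x, f y`, acting on the complex functions on the vertices. -/
def markovOperator {W : Type*} [Fintype W] (G : SimpleGraph W) :
    Module.End ℂ (W → ℂ) where
  toFun f x := (1 / (G.degree x : ℂ)) * ∑ y ∈ G.neighborFinset x, f y
  map_add' f g := by
    funext x
    simp [Finset.sum_add_distrib, mul_add]
  map_smul' c f := by
    funext x
    simp only [Pi.smul_apply, smul_eq_mul, RingHom.id_apply, ← Finset.mul_sum]
    ring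

/-- The edge lamplighter graph of `G`: a vertex is a pair `(ω, x)` of a configuration `ω` of the
lamps on the edges of `G` and a position `x`. Two vertices `(ω, x)` and `(θ, y)` are adjacent when
`x ~ y` in `G` and `ω`, `θ` agree on every edge other than `{x, y}`. -/
def edgeLamplighterGraph {V : Type*} (G : SimpleGraph V) :
    SimpleGraph ((G.edgeSet → ZMod 2) × V) where
  Adj p q := G.Adj p.2 q.2 ∧
    ∀ e : G.edgeSet, (e : Sym2 V) ≠ s(p.2, q.2) → p.1 e = q.1 e
  symm := ⟨fun p q h => ⟨h.1.symm, fun e he => (h.2 e (by rwa [Sym2.eq_swap])).symm⟩⟩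
  loopless := ⟨fun p h => G.loopless.irrefl p.2 h.1⟩

/-- The Markov operator of the edge lamplighter random walk on the cycle with `n` vertices. -/
def cycleEdgeLamplighter (n : ℕ) :
    Module.End ℂ ((((SimpleGraph.cycleGraph n).edgeSet → ZMod 2) × Fin n) → ℂ) :=
  markovOperator (edgeLamplighterGraph (SimpleGraph.cycleGraph n))

/-- The multiplicity of the number `c` as an eigenvalue of the edge lamplighter random walk on the
cycle with `n` vertices: the dimension of the eigenspace (which is `0` if `c` is not an
eigenvalue). -/
def eigenMultiplicity (n : ℕ) (c : ℝ) : ℕ :=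
  Module.finrank ℂ ((cycleEdgeLamplighter n).eigenspace (c : ℂ))

/-- The numbers `cos (h π / k)` with `3 ≤ k ≤ n + 1`, `1 ≤ h ≤ k - 1` and `gcd (h, k) = 1`. -/
def cosineValues (n : ℕ) : Set ℝ :=
  {c | ∃ k h : ℕ, 3 ≤ k ∧ k ≤ n + 1 ∧ 1 ≤ h ∧ h < k ∧ Nat.Coprime h k ∧
    c = Real.cos (h * Real.pi / k)}

end

/-! A step of the walk crosses an edge and rerandomises its lamp. A Fourier transform over the group
of lamp configurations therefore splits the operator into blocks indexed by sets `S` of edges.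
Averaging a character over the two states of a lamp gives 0 if its edge lies in `S` and 1 otherwise,
so the block of `S` is half the adjacency operator of the cycle with the edges of `S` removed. The
multiplicity of `c` is the sum over `S` of its multiplicities in these blocks
(`finrank_eigenspace_eq_sum`).

For nonempty `S` the cut cycle is a union of paths. A path on `d + 1` vertices has `c` as an
eigenvalue, and then a simple one, exactly when `U_{d+1}(c) = 0`, `U` being the Chebyshev polynomial
of the second kind. Double counting pairs (set, component) gives `n * ∑ d, 2 ^ (n - 2 - d)` over the
`d < n` with this property (`sum_finrank_cutCycleEigenspace`). For `c = cos (hπ/k)` the property is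
`k ∣ d + 2`, and the sum is geometric (`sum_two_pow_multiples`).

The intact cycle, `S = ∅`, is governed by `z` with `2c = z + z⁻¹`: it contributes 0 if `z ^ n ≠ 1`,
1 if `z = ±1` and `z ^ n = 1`, and 2 otherwise. This is the source of the eigenvalues `±1` and of
the extra 2 when `r = 1`. The eigenvalue 0 is the case `k = 2`, `h = 1` of the same formula. -/

noncomputable section
section
-- The lamplighter graph in cyclic coordinates
open scoped Fin.CommRing

/-- The edge `{i, i + 1}` of a cycle with at least three vertices. -/
def cycleEdge (N : ℕ) (i : Fin (N + 3)) : (SimpleGraph.cycleGraph (N + 3)).edgeSet :=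
  ⟨s(i, i + 1), by
    rw [SimpleGraph.mem_edgeSet, SimpleGraph.cycleGraph_adj]
    exact Or.inr (by ring)⟩

theorem cycleGraph_adj_iff_eq_add_or_sub (N : ℕ) (x y : Fin (N + 3)) :
    (SimpleGraph.cycleGraph (N + 3)).Adj x y ↔ y = x + 1 ∨ y = x - 1 := by
  rw [SimpleGraph.cycleGraph_adj]
  constructor
  · rintro (h | h)
    · right; rw [← h]; ring
    · left; rw [← h]; ring
  · rintro (h | h)
    · right; rw [h]; ring
    · left; rw [h]; ring

theorem fin_two_ne_zero (N : ℕ) : (2 : Fin (N + 3)) ≠ 0 := by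
  intro h
  have := congrArg Fin.val h
  simp [Nat.mod_eq_of_lt] at this

theorem fin_add_one_ne_sub_one (N : ℕ) (x : Fin (N + 3)) : x + 1 ≠ x - 1 := fun h =>
  fin_two_ne_zero N (by linear_combination h)

theorem cycleEdge_bijective (N : ℕ) : Function.Bijective (cycleEdge N) := by
  constructor
  · intro i j h
    have h' : s((i : Fin (N + 3)), i + 1) = s(j, j + 1) := congrArg Subtype.val h
    rw [Sym2.eq_iff] at h'
    rcases h' with h' | ⟨h1, h2⟩
    · exact h'.1
    · exact absurd (by linear_combination h2 - h1) (fin_two_ne_zero N)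
  · rintro ⟨e, he⟩
    induction e using Sym2.ind with
    | _ x y =>
      rw [SimpleGraph.mem_edgeSet, cycleGraph_adj_iff_eq_add_or_sub] at he
      rcases he with h | h
      · refine ⟨x, Subtype.ext ?_⟩
        subst h
        rfl
      · refine ⟨y, Subtype.ext ?_⟩
        have hx : x = (y + 1 : Fin (N + 3)) := by rw [h]; ring
        subst hx
        exact Sym2.eq_swap

/-- The configurations of the lamps on the edges of the cycle. -/
abbrev CycleLamps (N : ℕ) : Type := (SimpleGraph.cycleGraph (N + 3)).edgeSet → ZMod 2

open Classical in
/-- The configuration whose only lit lamp is on the edge `{i, i + 1}`. -/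
def singleLamp (N : ℕ) (i : Fin (N + 3)) : CycleLamps N := Pi.single (cycleEdge N i) 1

theorem agree_off_cycleEdge_iff (N : ℕ) (i : Fin (N + 3)) (ω θ : CycleLamps N) :
    (∀ e : (SimpleGraph.cycleGraph (N + 3)).edgeSet, e ≠ cycleEdge N i → ω e = θ e) ↔
      θ = ω ∨ θ = ω + singleLamp N i := by
  classical
  constructor
  · intro h
    have key : ∀ a b : ZMod 2, b = a ∨ b = a + 1 := by decide
    rcases key (ω (cycleEdge N i)) (θ (cycleEdge N i)) with h0 | h0
    · left
      funext e
      by_cases he : e = cycleEdge N i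
      · rw [he, h0]
      · exact (h e he).symm
    · right
      funext e
      by_cases he : e = cycleEdge N i
      · rw [he, h0]; simp [singleLamp]
      · simp [singleLamp, he, h e he]
  · rintro (h | h) e he
    · rw [h]
    · rw [h]; simp [singleLamp, he]

theorem add_singleLamp_ne (N : ℕ) (i : Fin (N + 3)) (ω : CycleLamps N) :
    ω ≠ ω + singleLamp N i := by
  intro h
  have := congrFun h (cycleEdge N i)
  simp [singleLamp] at this

theorem edgeLamplighterGraph_adj_iff (N : ℕ) (ω θ : CycleLamps N) (x y : Fin (N + 3)) :
    (edgeLamplighterGraph (SimpleGraph.cycleGraph (N + 3))).Adj (ω, x) (θ, y) ↔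
      (y = x + 1 ∧ (θ = ω ∨ θ = ω + singleLamp N x)) ∨
      (y = x - 1 ∧ (θ = ω ∨ θ = ω + singleLamp N (x - 1))) := by
  change ((SimpleGraph.cycleGraph (N + 3)).Adj x y ∧
    ∀ e : (SimpleGraph.cycleGraph (N + 3)).edgeSet,
      (e : Sym2 (Fin (N + 3))) ≠ s(x, y) → ω e = θ e) ↔ _
  rw [cycleGraph_adj_iff_eq_add_or_sub, or_and_right, ← agree_off_cycleEdge_iff, ← agree_off_cycleEdge_iff]
  have h1 : ∀ e : (SimpleGraph.cycleGraph (N + 3)).edgeSet,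
      e ≠ cycleEdge N x ↔ (e : Sym2 (Fin (N + 3))) ≠ s(x, x + 1) := fun e =>
    not_congr Subtype.ext_iff
  have h2 : ∀ e : (SimpleGraph.cycleGraph (N + 3)).edgeSet,
      e ≠ cycleEdge N (x - 1) ↔ (e : Sym2 (Fin (N + 3))) ≠ s(x, x - 1) := fun e => by
    rw [Sym2.eq_swap]
    refine not_congr (Subtype.ext_iff.trans ?_)
    change (e : Sym2 (Fin (N + 3))) = s(x - 1, x - 1 + 1) ↔ _
    rw [sub_add_cancel]
  refine or_congr (and_congr_right fun h => ?_) (and_congr_right fun h => ?_)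
  · simp only [h1, h]
  · simp only [h2, h]

theorem cycleEdgeLamplighter_apply (N : ℕ) (f : CycleLamps N × Fin (N + 3) → ℂ)
    (ω : CycleLamps N) (x : Fin (N + 3)) :
    cycleEdgeLamplighter (N + 3) f (ω, x) =
      (1 / 4) * (f (ω, x + 1) + f (ω + singleLamp N x, x + 1) +
        f (ω, x - 1) + f (ω + singleLamp N (x - 1), x - 1)) := by
  classical
  have hset : (edgeLamplighterGraph (SimpleGraph.cycleGraph (N + 3))).neighborFinset (ω, x) =
      ({(ω, x + 1), (ω + singleLamp N x, x + 1), (ω, x - 1),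
        (ω + singleLamp N (x - 1), x - 1)} : Finset (CycleLamps N × Fin (N + 3))) := by
    ext ⟨θ, y⟩
    rw [SimpleGraph.mem_neighborFinset, edgeLamplighterGraph_adj_iff]
    simp only [Finset.mem_insert, Finset.mem_singleton, Prod.mk.injEq]
    tauto
  have hne := fin_add_one_ne_sub_one N x
  have h1 := add_singleLamp_ne N x ω
  have h2 := add_singleLamp_ne N (x - 1) ω
  -- Two directions times two lamp states; the directions differ because the cycle has at least
  -- three vertices.
  have hcard : (edgeLamplighterGraph (SimpleGraph.cycleGraph (N + 3))).degree (ω, x) = 4 := by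
    rw [← SimpleGraph.card_neighborFinset_eq_degree, hset, Finset.card_insert_of_notMem,
      Finset.card_insert_of_notMem, Finset.card_insert_of_notMem, Finset.card_singleton]
    all_goals simp only [Finset.mem_insert, Finset.mem_singleton, Prod.mk.injEq]; tauto
  change (1 / ((SimpleGraph.degree _ (ω, x) : ℕ) : ℂ)) * (∑ y ∈ SimpleGraph.neighborFinset _ (ω, x), f y) = _
  have hs : ∑ y ∈ (edgeLamplighterGraph (SimpleGraph.cycleGraph (N + 3))).neighborFinset (ω, x), f y
      = f (ω, x + 1) + f (ω + singleLamp N x, x + 1) +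
        f (ω, x - 1) + f (ω + singleLamp N (x - 1), x - 1) := by
    rw [hset, Finset.sum_insert, Finset.sum_insert, Finset.sum_insert, Finset.sum_singleton]
    · ring
    all_goals simp only [Finset.mem_insert, Finset.mem_singleton, Prod.mk.injEq]; tauto
  rw [← hs]
  rw [show (4 : ℂ) = ((4 : ℕ) : ℂ) by norm_num, ← hcard]

/-! ### Fourier transform in the lamps -/

/-- The nontrivial character of `ℤ / 2`. -/
def zmodTwoSign (a : ZMod 2) : ℂ := if a = 0 then 1 else -1

theorem zmodTwoSign_add_one (a : ZMod 2) : zmodTwoSign (a + 1) = -zmodTwoSign a := by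
  have key : ∀ a : ZMod 2, a + 1 = 0 ↔ a ≠ 0 := by decide
  by_cases h : a = 0 <;> simp [zmodTwoSign, key, h]

theorem one_add_zmodTwoSign_mul (a b : ZMod 2) :
    1 + zmodTwoSign a * zmodTwoSign b = if a = b then 2 else 0 := by
  have key : ∀ a b : ZMod 2, a = b ↔ (a = 0 ↔ b = 0) := by decide
  rw [if_congr (key a b) rfl rfl, zmodTwoSign, zmodTwoSign]
  by_cases ha : a = 0 <;> by_cases hb : b = 0 <;> simp only [ha, hb] <;> norm_num

/-- The character of the group of configurations attached to a set of edges. -/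
def lampCharacter (N : ℕ) (S : Finset (Fin (N + 3))) (ω : CycleLamps N) : ℂ :=
  ∏ i ∈ S, zmodTwoSign (ω (cycleEdge N i))

theorem lampCharacter_add_singleLamp (N : ℕ) (S : Finset (Fin (N + 3))) (ω : CycleLamps N)
    (i : Fin (N + 3)) :
    lampCharacter N S (ω + singleLamp N i) =
      (if i ∈ S then -1 else 1) * lampCharacter N S ω := by
  classical
  have h : ∀ j, zmodTwoSign ((ω + singleLamp N i) (cycleEdge N j)) =
      (if i = j then -1 else 1) * zmodTwoSign (ω (cycleEdge N j)) := by
    intro j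
    by_cases hij : i = j
    · subst hij
      simp [singleLamp, zmodTwoSign_add_one]
    · have : cycleEdge N j ≠ cycleEdge N i := fun h => hij ((cycleEdge_bijective N).1 h).symm
      simp [singleLamp, hij, this]
  simp only [lampCharacter, h, Finset.prod_mul_distrib, Finset.prod_ite_eq]

/-- The sum over subsets is the expansion of a product of factors `1 + χ χ'`, one per edge; a factor
is 2 where the lamps agree and 0 where they differ. -/
theorem sum_lampCharacter_mul (N : ℕ) (ω θ : CycleLamps N) :
    ∑ S : Finset (Fin (N + 3)), lampCharacter N S ω * lampCharacter N S θ =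
      if ω = θ then 2 ^ (N + 3) else 0 := by
  classical
  simp only [lampCharacter, ← Finset.prod_mul_distrib]
  rw [← Finset.powerset_univ, ← Finset.prod_one_add]
  simp only [one_add_zmodTwoSign_mul]
  split_ifs with h
  · subst h
    simp [Fintype.card_fin]
  · obtain ⟨e, he⟩ := Function.ne_iff.mp h
    obtain ⟨i, rfl⟩ := (cycleEdge_bijective N).2 e
    exact Finset.prod_eq_zero (Finset.mem_univ i) (if_neg he)

/-- The Fourier transform in the configuration of the lamps. -/
def lampFourier (N : ℕ) :
    (CycleLamps N × Fin (N + 3) → ℂ) →ₗ[ℂ] (Finset (Fin (N + 3)) → Fin (N + 3) → ℂ) where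
  toFun f S x := ∑ ω, lampCharacter N S ω * f (ω, x)
  map_add' f g := by
    funext S x
    simp [mul_add, Finset.sum_add_distrib]
  map_smul' c f := by
    funext S x
    simp only [Pi.smul_apply, smul_eq_mul, RingHom.id_apply, Finset.mul_sum]
    exact Finset.sum_congr rfl fun _ _ => by ring

theorem lampFourier_injective (N : ℕ) : Function.Injective (lampFourier N) := by
  classical
  rw [← LinearMap.ker_eq_bot, LinearMap.ker_eq_bot']
  intro f hf
  funext ⟨θ, x⟩
  have h : ∑ S, lampCharacter N S θ * lampFourier N f S x = 2 ^ (N + 3) * f (θ, x) := by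
    change ∑ S, lampCharacter N S θ * (∑ ω, lampCharacter N S ω * f (ω, x)) = _
    simp only [Finset.mul_sum, ← mul_assoc]
    rw [Finset.sum_comm]
    simp only [← Finset.sum_mul, sum_lampCharacter_mul]
    simp
  rw [hf] at h
  simpa using h.symm

/-- Injectivity comes from Fourier inversion; there are as many configurations as sets of edges, so
the dimensions agree. -/
theorem lampFourier_bijective (N : ℕ) : Function.Bijective (lampFourier N) := by
  classical
  refine ⟨lampFourier_injective N, ?_⟩
  let e := Equiv.ofBijective _ (cycleEdge_bijective N)
  have hc : Fintype.card (CycleLamps N) = Fintype.card (Finset (Fin (N + 3))) := by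
    rw [Fintype.card_fun, ZMod.card, Fintype.card_finset, Fintype.card_congr e]
  let E : (CycleLamps N × Fin (N + 3) → ℂ) ≃ₗ[ℂ] (Finset (Fin (N + 3)) → Fin (N + 3) → ℂ) :=
    (LinearEquiv.funCongrLeft ℂ ℂ
      ((Fintype.equivOfCardEq hc).symm.prodCongr (Equiv.refl (Fin (N + 3))))).trans
      (LinearEquiv.curry ℂ ℂ _ _)
  exact (LinearMap.injective_iff_surjective_of_finrank_eq_finrank E.finrank_eq).1
    (lampFourier_injective N)

theorem sum_lampCharacter_mul_shift (N : ℕ) (S : Finset (Fin (N + 3))) (i : Fin (N + 3))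
    (f : CycleLamps N → ℂ) :
    ∑ ω, lampCharacter N S ω * f (ω + singleLamp N i) =
      (if i ∈ S then -1 else 1) * ∑ ω, lampCharacter N S ω * f ω := by
  have h2 : singleLamp N i + singleLamp N i = 0 := by
    funext e
    exact CharTwo.add_self_eq_zero _
  rw [← Equiv.sum_comp (Equiv.addRight (singleLamp N i))
    (fun ω => lampCharacter N S ω * f (ω + singleLamp N i)), Finset.mul_sum]
  refine Finset.sum_congr rfl fun ω _ => ?_
  simp only [Equiv.coe_addRight, add_assoc, h2, add_zero, lampCharacter_add_singleLamp]
  ring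

/-- The two lamp states of a crossed edge contribute `1 + 1` or `1 - 1`, so the edges of `S`
disappear and `1 / 4` becomes `1 / 2`. -/
theorem lampFourier_cycleEdgeLamplighter (N : ℕ) (f : CycleLamps N × Fin (N + 3) → ℂ)
    (S : Finset (Fin (N + 3))) (x : Fin (N + 3)) :
    lampFourier N (cycleEdgeLamplighter (N + 3) f) S x =
      (1 / 2) * ((if x ∈ S then 0 else lampFourier N f S (x + 1)) +
        (if x - 1 ∈ S then 0 else lampFourier N f S (x - 1))) := by
  have h1 := sum_lampCharacter_mul_shift N S x (fun ω => f (ω, x + 1))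
  have h2 := sum_lampCharacter_mul_shift N S (x - 1) (fun ω => f (ω, x - 1))
  have h : lampFourier N (cycleEdgeLamplighter (N + 3) f) S x = (1 / 4) *
      (lampFourier N f S (x + 1) + (if x ∈ S then -1 else 1) * lampFourier N f S (x + 1) +
        lampFourier N f S (x - 1) + (if x - 1 ∈ S then -1 else 1) * lampFourier N f S (x - 1)) := by
    change ∑ ω, lampCharacter N S ω * cycleEdgeLamplighter (N + 3) f (ω, x) =
      (1 / 4) * (∑ ω, lampCharacter N S ω * f (ω, x + 1) +
        _ * (∑ ω, lampCharacter N S ω * f (ω, x + 1)) +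
        ∑ ω, lampCharacter N S ω * f (ω, x - 1) +
        _ * (∑ ω, lampCharacter N S ω * f (ω, x - 1)))
    rw [← h1, ← h2, ← Finset.sum_add_distrib, ← Finset.sum_add_distrib, ← Finset.sum_add_distrib,
      Finset.mul_sum]
    refine Finset.sum_congr rfl fun ω _ => ?_
    rw [cycleEdgeLamplighter_apply]
    ring
  rw [h]
  split_ifs <;> ring

/-- The functions `g` on the cycle with `n` vertices, with the edges `{i, i + 1}`, `i ∈ S`, removed, which
are eigenfunctions of half the adjacency operator for `c`. -/
def cutCycleEigenspace {n : ℕ} [NeZero n] (S : Finset (Fin n)) (c : ℂ) : Submodule ℂ (Fin n → ℂ) where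
  carrier := {g | ∀ x, (if x ∈ S then 0 else g (x + 1)) + (if x - 1 ∈ S then 0 else g (x - 1)) =
    2 * c * g x}
  add_mem' {f g} hf hg x := by
    have h1 := hf x
    have h2 := hg x
    simp only [Pi.add_apply]
    split_ifs at * <;> linear_combination h1 + h2
  zero_mem' x := by simp
  smul_mem' a f hf x := by
    have h1 := hf x
    simp only [Pi.smul_apply, smul_eq_mul]
    split_ifs at * <;> linear_combination a * h1

theorem mem_cutCycleEigenspace {n : ℕ} [NeZero n] {S : Finset (Fin n)} {c : ℂ} {g : Fin n → ℂ} :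
    g ∈ cutCycleEigenspace S c ↔ ∀ x, (if x ∈ S then 0 else g (x + 1)) +
      (if x - 1 ∈ S then 0 else g (x - 1)) = 2 * c * g x := Iff.rfl

theorem mem_eigenspace_iff_lampFourier (N : ℕ) (c : ℂ) (f : CycleLamps N × Fin (N + 3) → ℂ) :
    f ∈ (cycleEdgeLamplighter (N + 3)).eigenspace c ↔
      ∀ S, lampFourier N f S ∈ cutCycleEigenspace S c := by
  rw [Module.End.mem_eigenspace_iff, ← (lampFourier_injective N).eq_iff, map_smul, funext_iff]
  refine forall_congr' fun S => ?_
  rw [funext_iff, mem_cutCycleEigenspace]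
  refine forall_congr' fun x => ?_
  rw [lampFourier_cycleEdgeLamplighter]
  simp only [Pi.smul_apply, smul_eq_mul]
  constructor
  · intro h
    linear_combination 2 * h
  · intro h
    linear_combination (1 / 2) * h

theorem finrank_eigenspace_eq_sum (N : ℕ) (c : ℂ) :
    Module.finrank ℂ ((cycleEdgeLamplighter (N + 3)).eigenspace c) =
      ∑ S : Finset (Fin (N + 3)), Module.finrank ℂ (cutCycleEigenspace S c) := by
  rw [← Module.finrank_pi_fintype]
  let L : (cycleEdgeLamplighter (N + 3)).eigenspace c →ₗ[ℂ]
      (∀ S : Finset (Fin (N + 3)), cutCycleEigenspace S c) :=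
    LinearMap.pi fun S => LinearMap.codRestrict _
      ((LinearMap.proj S).comp ((lampFourier N).comp (Submodule.subtype _)))
      (fun f => (mem_eigenspace_iff_lampFourier N c f).1 f.2 S)
  refine (LinearEquiv.ofBijective L ⟨?_, ?_⟩).finrank_eq
  · intro f g h
    refine Subtype.ext (lampFourier_injective N (funext fun S => ?_))
    exact congrArg Subtype.val (congrFun h S)
  · intro G
    obtain ⟨f, hf⟩ := (lampFourier_bijective N).2 fun S => (G S : Fin (N + 3) → ℂ)
    refine ⟨⟨f, (mem_eigenspace_iff_lampFourier N c f).2 fun S => ?_⟩, ?_⟩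
    · rw [hf]
      exact (G S).2
    · funext S
      exact Subtype.ext (congrFun hf S)

end

end

/-! ### The cycle with at least one edge removed -/

noncomputable section
section
open scoped Fin.CommRing

theorem fin_cyclic_induction {n : ℕ} [NeZero n] {P : Fin n → Prop} (x : Fin n) (h0 : P x)
    (hs : ∀ y, P y → P (y + 1)) (y : Fin n) : P y := by
  have h : ∀ j : ℕ, P (x + (j : Fin n)) := by
    intro j
    induction j with
    | zero => simpa using h0
    | succ j ih =>
      have := hs _ ih
      rwa [add_assoc, ← Nat.cast_succ] at this
  have h1 := h (y - x).val
  rwa [Fin.cast_val_eq_self, add_sub_cancel] at h1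

theorem fin_val_add_one_eq_ite {n : ℕ} [NeZero n] (hn : 2 ≤ n) (z : Fin n) :
    (z + 1).val = if z.val + 1 = n then 0 else z.val + 1 := by
  have hz := z.isLt
  have h1 : (1 : Fin n).val = 1 := by
    rw [Fin.val_one', Nat.mod_eq_of_lt hn]
  rw [Fin.val_add, h1]
  split_ifs with h
  · rw [h, Nat.mod_self]
  · exact Nat.mod_eq_of_lt (by omega)

/-- The vertices `x, x + 1, …, x + d` form a connected component of the cycle with the edges
`{i, i + 1}`, `i ∈ S`, removed. -/
def IsCutComponent {n : ℕ} [NeZero n] (S : Finset (Fin n)) (p : Fin n × Fin n) : Prop :=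
  p.1 - 1 ∈ S ∧ p.1 + p.2 ∈ S ∧ ∀ j < p.2, p.1 + j ∉ S

theorem exists_isCutComponent {n : ℕ} [NeZero n] {S : Finset (Fin n)} {x : Fin n}
    (hx : x - 1 ∈ S) : ∃ d, IsCutComponent S (x, d) := by
  classical
  let A : Finset (Fin n) := Finset.univ.filter fun d => x + d ∈ S
  -- The offset `-1` leads once around the cycle, back to the cut edge before `x`.
  have hA : A.Nonempty := ⟨-1, by simpa [A, sub_eq_add_neg] using hx⟩
  refine ⟨A.min' hA, hx, ?_, fun j hj hjS => ?_⟩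
  · simpa [A] using A.min'_mem hA
  · exact absurd (A.min'_le j (by simpa [A] using hjS)) (not_le.2 hj)

/-- If the start of `q` lay further inside `p`, the cut edge before it would be an interior edge of
`p`. With equal starts, both lengths are the first offset that meets `S`. -/
theorem IsCutComponent.eq_of_le {n : ℕ} [NeZero n] {S : Finset (Fin n)} {p q : Fin n × Fin n}
    (hp : IsCutComponent S p) (hq : IsCutComponent S q) (h : q.1 - p.1 ≤ p.2) : q = p := by
  obtain ⟨x, d⟩ := p
  obtain ⟨y, e⟩ := q
  simp only at h
  have hxy : y = x := by
    by_contra hne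
    have h0 : y - x ≠ 0 := sub_ne_zero.2 hne
    have h1 : y - x - 1 < y - x := by
      rw [Fin.lt_def]
      have hpos : (y - x).val ≠ 0 := fun hh => h0 (Fin.ext hh)
      rw [Fin.val_sub_one_of_ne_zero h0]
      omega
    have h2 := hp.2.2 _ (lt_of_lt_of_le h1 h)
    apply h2
    have := hq.1
    simp only at this ⊢
    rwa [show x + (y - x - 1) = y - 1 by ring]
  subst hxy
  have hed : e = d := by
    rcases lt_trichotomy e d with h1 | h1 | h1
    · exact absurd hq.2.1 (hp.2.2 e h1)
    · exact h1
    · exact absurd hp.2.1 (hq.2.2 d h1)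
  rw [hed]

/-- The value at `c` of the Chebyshev polynomial of the second kind. -/
def chebyshevU (m : ℤ) (c : ℂ) : ℂ := (Polynomial.Chebyshev.U ℂ m).eval c

theorem chebyshevU_neg_one (c : ℂ) : chebyshevU (-1) c = 0 := by simp [chebyshevU]

theorem chebyshevU_zero (c : ℂ) : chebyshevU 0 c = 1 := by simp [chebyshevU]

theorem chebyshevU_add_one (m : ℤ) (c : ℂ) :
    chebyshevU (m + 1) c = 2 * c * chebyshevU m c - chebyshevU (m - 1) c := by
  simp [chebyshevU, Polynomial.Chebyshev.U_add_one]

/-- The function supported on the path `x, x + 1, …, x + d` whose values there are those of the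
Chebyshev polynomials of the second kind. -/
def pathEigenfunction {n : ℕ} [NeZero n] (c : ℂ) (p : Fin n × Fin n) (y : Fin n) : ℂ :=
  if y - p.1 ≤ p.2 then chebyshevU (y - p.1).val c else 0

/-- The eigenvalue equation is the Chebyshev recurrence; `U_{-1} = 0` and `U_{d+1}(c) = 0` play the
role of the missing neighbours at the two ends. -/
theorem pathEigenfunction_mem {n : ℕ} [NeZero n] (hn : 2 ≤ n) {S : Finset (Fin n)} {c : ℂ}
    {p : Fin n × Fin n} (hp : IsCutComponent S p) (hc : chebyshevU ((p.2.val : ℤ) + 1) c = 0) :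
    pathEigenfunction c p ∈ cutCycleEigenspace S c := by
  obtain ⟨x, d⟩ := p
  obtain ⟨h1, h2, h3⟩ := hp
  simp only at h1 h2 h3 hc
  rw [mem_cutCycleEigenspace]
  intro y
  obtain ⟨z, rfl⟩ : ∃ z, y = x + z := ⟨y - x, by ring⟩
  obtain ⟨w, rfl⟩ : ∃ w, z = w + 1 := ⟨z - 1, by ring⟩
  have e1 : x + (w + 1) + 1 - x = w + 1 + 1 := by ring
  have e2 : x + (w + 1) - 1 = x + w := by ring
  have e3 : x + w - x = w := by ring
  have e4 : x + (w + 1) - x = w + 1 := by ring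
  simp only [pathEigenfunction, e1, e2, e3, e4]
  have hw := fin_val_add_one_eq_ite hn w
  have hw1 := fin_val_add_one_eq_ite hn (w + 1)
  have hd := d.isLt
  have hwn := w.isLt
  -- The offset `n - 1` is the vertex just before `x`, so the edge after it is cut. This controls
  -- the wrap-around of `Fin` values.
  have hlast : ∀ v : Fin n, v.val + 1 = n → x + v ∈ S := by
    intro v hv
    have : v + 1 = 0 := Fin.ext (by rw [fin_val_add_one_eq_ite hn, if_pos hv]; rfl)
    rwa [show x + v = x - 1 by linear_combination this]
  have hU := chebyshevU_add_one ((w + 1 : Fin n).val : ℤ) c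
  -- `A` and `B` rewrite the right and left neighbour terms as Chebyshev values valid along the
  -- whole path, ends included.
  have A : (if x + (w + 1) ∈ S then (0 : ℂ) else if w + 1 + 1 ≤ d then
      chebyshevU (w + 1 + 1 : Fin n).val c else 0) =
      if w + 1 ≤ d then chebyshevU ((w + 1 : Fin n).val + 1) c else 0 := by
    by_cases hle : w + 1 ≤ d
    · rw [if_pos hle]
      rcases hle.lt_or_eq with hlt | heq
      · rw [if_neg (h3 _ hlt)]
        rw [Fin.lt_def] at hlt
        rw [if_neg (by omega)] at hw1
        rw [if_pos (by rw [Fin.le_def]; omega), hw1]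
        push_cast
        rfl
      · rw [heq, if_pos h2, hc]
    · rw [if_neg hle]
      by_cases hS : x + (w + 1) ∈ S
      · rw [if_pos hS]
      · rw [if_neg hS, if_neg]
        rw [if_neg (fun hh => hS (hlast _ hh))] at hw1
        rw [Fin.le_def] at hle ⊢
        omega
  have B : (if x + w ∈ S then (0 : ℂ) else if w ≤ d then chebyshevU w.val c else 0) =
      if w + 1 ≤ d then chebyshevU ((w + 1 : Fin n).val - 1) c else 0 := by
    by_cases hle : w + 1 ≤ d
    · rw [if_pos hle]
      by_cases hw0 : w.val + 1 = n
      · rw [if_pos (hlast w hw0), hw, if_pos hw0]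
        exact (chebyshevU_neg_one c).symm
      · rw [if_neg hw0] at hw
        rw [Fin.le_def] at hle
        have hwd : w < d := by rw [Fin.lt_def]; omega
        rw [if_neg (h3 w hwd), if_pos hwd.le, hw]
        push_cast
        rw [add_sub_cancel_right]
    · rw [if_neg hle]
      by_cases hS : x + w ∈ S
      · rw [if_pos hS]
      · rw [if_neg hS, if_neg]
        rw [if_neg (fun hh => hS (hlast _ hh))] at hw
        intro hwd
        rcases hwd.lt_or_eq with hlt | heq
        · rw [Fin.lt_def] at hlt
          rw [Fin.le_def] at hle
          omega
        · rw [heq] at hS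
          exact hS h2
  rw [A, B]
  by_cases hle : w + 1 ≤ d
  · simp only [if_pos hle]
    linear_combination hU
  · simp only [if_neg hle]
    ring

/-- The starting value determines an eigenfunction along its component. At `j = d` the edge is cut,
and the first conjunct becomes the boundary condition `U_{d+1}(c) * g x = 0`. -/
theorem cutCycleEigenspace_apply_add {n : ℕ} [NeZero n] {S : Finset (Fin n)} {c : ℂ}
    {p : Fin n × Fin n} (hp : IsCutComponent S p) {g : Fin n → ℂ}
    (hg : g ∈ cutCycleEigenspace S c) (j : ℕ) (hj : j ≤ p.2.val) :
    (if p.1 + (j : Fin n) ∈ S then 0 else g (p.1 + j + 1)) = chebyshevU (j + 1) c * g p.1 ∧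
      g (p.1 + j) = chebyshevU j c * g p.1 := by
  obtain ⟨x, d⟩ := p
  obtain ⟨h1, h2, h3⟩ := hp
  simp only at *
  rw [mem_cutCycleEigenspace] at hg
  induction j with
  | zero =>
    have h := hg x
    rw [if_pos h1] at h
    have hU := chebyshevU_add_one 0 c
    rw [chebyshevU_zero, zero_sub, chebyshevU_neg_one] at hU
    simp only [Nat.cast_zero, add_zero]
    rw [hU, chebyshevU_zero]
    exact ⟨by linear_combination h, by ring⟩
  | succ j ih =>
    obtain ⟨ih1, ih2⟩ := ih (by omega)
    have hjd : (j : Fin n) < d := by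
      rw [Fin.lt_def, Fin.val_natCast]
      exact lt_of_le_of_lt (Nat.mod_le _ _) hj
    have hjS := h3 _ hjd
    rw [if_neg hjS] at ih1
    have h := hg (x + j + 1)
    rw [add_sub_cancel_right, if_neg hjS, ih1, ih2] at h
    have hU := chebyshevU_add_one (j + 1) c
    rw [add_sub_cancel_right] at hU
    push_cast
    simp only [← add_assoc]
    rw [hU, ih1]
    exact ⟨by linear_combination h, rfl⟩

theorem cutCycleEigenspace_eq_zero {n : ℕ} [NeZero n] {S : Finset (Fin n)} {c : ℂ}
    (hS : S.Nonempty) {g : Fin n → ℂ} (hg : g ∈ cutCycleEigenspace S c)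
    (h : ∀ x, x - 1 ∈ S → g x = 0) : g = 0 := by
  rw [mem_cutCycleEigenspace] at hg
  obtain ⟨s, hs⟩ := hS
  have hstart : ∀ y, y ∈ S → g (y + 1) = 0 ∧ (y + 1 ∉ S → g (y + 1 + 1) = 0) := by
    intro y hy
    have h0 := h (y + 1) (by rwa [add_sub_cancel_right])
    refine ⟨h0, fun hy1 => ?_⟩
    have h1 := hg (y + 1)
    rw [add_sub_cancel_right, if_pos hy, if_neg hy1, h0] at h1
    linear_combination h1
  -- Two consecutive zeros propagate through the recurrence, and each cut restarts it with a zero by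
  -- `h`.
  have key : ∀ y, g y = 0 ∧ (y ∉ S → g (y + 1) = 0) := by
    refine fin_cyclic_induction (s + 1) (hstart s hs) fun y hy => ?_
    by_cases hyS : y ∈ S
    · exact hstart y hyS
    · refine ⟨hy.2 hyS, fun hy1 => ?_⟩
      have h1 := hg (y + 1)
      rw [add_sub_cancel_right, if_neg hyS, if_neg hy1, hy.2 hyS, hy.1] at h1
      linear_combination h1
  exact funext fun y => (key y).1

open Classical in
-- Evaluation at the starts of the components with `U_{d+1}(c) = 0` is an isomorphism: on other
-- components the boundary condition forces 0, and the path eigenfunctions form the dual basis.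
theorem finrank_cutCycleEigenspace {n : ℕ} [NeZero n] (hn : 2 ≤ n) {S : Finset (Fin n)} (c : ℂ)
    (hS : S.Nonempty) : Module.finrank ℂ (cutCycleEigenspace S c) =
      (Finset.univ.filter fun p : Fin n × Fin n =>
        IsCutComponent S p ∧ chebyshevU ((p.2.val : ℤ) + 1) c = 0).card := by
  let Q := {p : Fin n × Fin n // IsCutComponent S p ∧ chebyshevU ((p.2.val : ℤ) + 1) c = 0}
  have hQ : Module.finrank ℂ (Q → ℂ) = (Finset.univ.filter fun p : Fin n × Fin n =>
        IsCutComponent S p ∧ chebyshevU ((p.2.val : ℤ) + 1) c = 0).card := by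
    rw [Module.finrank_fintype_fun_eq_card, Fintype.card_subtype]
  rw [← hQ]
  let L : cutCycleEigenspace S c →ₗ[ℂ] (Q → ℂ) :=
    (LinearMap.funLeft ℂ ℂ fun p : Q => p.1.1).comp (Submodule.subtype _)
  refine (LinearEquiv.ofBijective L ⟨?_, ?_⟩).finrank_eq
  · rw [← LinearMap.ker_eq_bot, LinearMap.ker_eq_bot']
    rintro ⟨g, hg⟩ hLg
    refine Subtype.ext (cutCycleEigenspace_eq_zero hS hg fun x hx => ?_)
    obtain ⟨d, hd⟩ := exists_isCutComponent hx
    by_cases hc : chebyshevU ((d.val : ℤ) + 1) c = 0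
    · exact congrFun hLg ⟨(x, d), hd, hc⟩
    · have h1 := (cutCycleEigenspace_apply_add hd hg d.val le_rfl).1
      rw [Fin.cast_val_eq_self, if_pos hd.2.1] at h1
      exact (mul_eq_zero.1 h1.symm).resolve_left hc
  · intro a
    refine ⟨∑ p : Q, a p • ⟨pathEigenfunction c p.1, pathEigenfunction_mem hn p.2.1 p.2.2⟩, ?_⟩
    funext q
    have hv : ∀ p : Q, pathEigenfunction c p.1 q.1.1 = if p = q then 1 else 0 := by
      intro p
      by_cases hpq : p = q
      · subst hpq
        simp [pathEigenfunction, chebyshevU_zero]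
      · rw [if_neg hpq, pathEigenfunction, if_neg]
        exact fun h => hpq (Subtype.ext (p.2.1.eq_of_le q.2.1 h).symm)
    change (((∑ p : Q, a p • (⟨pathEigenfunction c p.1, pathEigenfunction_mem hn p.2.1 p.2.2⟩ :
      cutCycleEigenspace S c) : cutCycleEigenspace S c) : Fin n → ℂ)) q.1.1 = a q
    simp only [AddSubmonoidClass.coe_finsetSum, SetLike.mk_smul_mk, Finset.sum_apply,
      Pi.smul_apply, hv, smul_eq_mul]
    rw [Finset.sum_eq_single q (fun p _ h => by rw [if_neg h, mul_zero]) (by simp), if_pos rfl,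
      mul_one]

open Classical in
-- The admissible `S` form an interval of the Boolean lattice: the two boundary edges are prescribed
-- and the `d` interior edges forbidden.
theorem card_filter_isCutComponent {n : ℕ} [NeZero n] (p : Fin n × Fin n) :
    (Finset.univ.filter fun S : Finset (Fin n) => IsCutComponent S p).card =
      2 ^ (n - 2 - p.2.val) := by
  obtain ⟨x, d⟩ := p
  let B : Finset (Fin n) := (Finset.Iio d).image (x + ·)
  have hB : B.card = d.val := by
    rw [Finset.card_image_of_injective _ (add_right_injective x), Fin.card_Iio]
  have hmem : ∀ j, x + j ∈ B ↔ j < d := by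
    intro j
    simp [B]
  have hset : (Finset.univ.filter fun S : Finset (Fin n) => IsCutComponent S (x, d)) =
      Finset.Icc {x - 1, x + d} Bᶜ := by
    ext S
    rw [Finset.mem_filter, Finset.mem_Icc]
    simp only [Finset.mem_univ, true_and, IsCutComponent, Finset.insert_subset_iff, Finset.singleton_subset_iff, and_assoc]
    refine and_congr_right fun _ => and_congr_right fun _ => ?_
    rw [Finset.subset_compl_comm]
    constructor
    · intro h y hy
      rw [show y = x + (y - x) by ring, hmem] at hy
      have := h _ hy
      rw [show x + (y - x) = y by ring] at this
      simpa using this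
    · intro h j hj
      simpa using h ((hmem j).2 hj)
  have hlt := d.isLt
  have hlast : d.val + 1 = n → d = -1 := by
    intro h
    refine eq_neg_of_add_eq_zero_left (Fin.ext ?_)
    rw [Fin.val_add, Fin.val_one', Nat.add_mod_mod, h, Nat.mod_self]
    rfl
  have hlast' : d = -1 → d.val + 1 = n := by
    rintro rfl
    by_contra h
    have h1 : (-1 + 1 : Fin n).val = 0 := by rw [neg_add_cancel]; rfl
    rw [Fin.val_add, Fin.val_one', Nat.add_mod_mod, Nat.mod_eq_of_lt (by omega)] at h1
    omega
  have hsub : ({x - 1, x + d} : Finset (Fin n)) ⊆ Bᶜ := by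
    rw [Finset.insert_subset_iff, Finset.singleton_subset_iff, Finset.mem_compl, Finset.mem_compl,
      hmem, sub_eq_add_neg, hmem]
    refine ⟨fun h => ?_, lt_irrefl d⟩
    have h2 : (-1 : Fin n).val + 1 = n := by
      by_contra h
      have h1 : (-1 + 1 : Fin n).val = 0 := by rw [neg_add_cancel]; rfl
      have h3 := (-1 : Fin n).isLt
      rw [Fin.val_add, Fin.val_one', Nat.add_mod_mod, Nat.mod_eq_of_lt (by omega)] at h1
      omega
    rw [Fin.lt_def] at h
    omega
  rw [hset, Finset.card_Icc_finset hsub, Finset.card_compl, hB, Fintype.card_fin]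
  congr 1
  change _ = n - 2 - d.val
  -- For `d = n - 1` the two boundary edges coincide and exactly one `S` remains, which is what the
  -- truncated exponent 0 gives.
  by_cases hd : d = -1
  · have := hlast' hd
    rw [hd, ← sub_eq_add_neg, Finset.insert_eq_of_mem (Finset.mem_singleton_self _),
      Finset.card_singleton, ← hd]
    omega
  · rw [Finset.card_pair]
    · omega
    · intro h
      exact hd (by linear_combination -h)

open Classical in
theorem sum_finrank_cutCycleEigenspace {n : ℕ} [NeZero n] (hn : 2 ≤ n) (c : ℂ) :
    ∑ S : Finset (Fin n), Module.finrank ℂ (cutCycleEigenspace S c) =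
      n * ∑ d ∈ Finset.range n, (if chebyshevU ((d : ℤ) + 1) c = 0 then 2 ^ (n - 2 - d) else 0) +
        Module.finrank ℂ (cutCycleEigenspace (∅ : Finset (Fin n)) c) := by
  have h : ∀ S : Finset (Fin n), Module.finrank ℂ (cutCycleEigenspace S c) =
      (Finset.univ.filter fun p : Fin n × Fin n =>
        IsCutComponent S p ∧ chebyshevU ((p.2.val : ℤ) + 1) c = 0).card +
      if S = ∅ then Module.finrank ℂ (cutCycleEigenspace (∅ : Finset (Fin n)) c) else 0 := by
    intro S
    rcases S.eq_empty_or_nonempty with rfl | hS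
    · simp [IsCutComponent]
    · rw [finrank_cutCycleEigenspace hn c hS, if_neg hS.ne_empty, add_zero]
  rw [Finset.sum_congr rfl fun S _ => h S, Finset.sum_add_distrib]
  congr 1
  · have h2 : ∀ S : Finset (Fin n), (Finset.univ.filter fun p : Fin n × Fin n =>
        IsCutComponent S p ∧ chebyshevU ((p.2.val : ℤ) + 1) c = 0).card =
        ∑ p : Fin n × Fin n, if chebyshevU ((p.2.val : ℤ) + 1) c = 0 then
          (if IsCutComponent S p then 1 else 0) else 0 := by
      intro S
      rw [Finset.card_filter]
      refine Finset.sum_congr rfl fun p _ => ?_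
      rw [← ite_and]
      simp only [and_comm]
    simp only [h2]
    rw [Finset.sum_comm]
    have h3 : ∀ p : Fin n × Fin n, (∑ S : Finset (Fin n),
        if chebyshevU ((p.2.val : ℤ) + 1) c = 0 then
          (if IsCutComponent S p then 1 else 0) else 0) =
        if chebyshevU ((p.2.val : ℤ) + 1) c = 0 then 2 ^ (n - 2 - p.2.val) else 0 := by
      intro p
      split_ifs
      · rw [← card_filter_isCutComponent p, Finset.card_filter]
      · simp
    simp only [h3]
    rw [Fintype.sum_prod_type]
    simp only
    rw [Fin.sum_univ_eq_sum_range
      (fun d => if chebyshevU ((d : ℤ) + 1) c = 0 then 2 ^ (n - 2 - d) else 0) n]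
    simp
  · simp

end

end

/-! ### The intact cycle -/

noncomputable section
section
open scoped Fin.CommRing

theorem fin_geometric_eq_zero {n : ℕ} [NeZero n] {w : ℂ} {g : Fin n → ℂ}
    (h : ∀ x, g (x + 1) = w * g x) (h0 : g 0 = 0) : g = 0 :=
  funext fun x => fin_cyclic_induction (P := fun y => g y = 0) 0 h0
    (fun y hy => by rw [h, hy, mul_zero]) x

theorem fin_geometric_eq_zero_of_pow_ne_one {n : ℕ} [NeZero n] {w : ℂ} {g : Fin n → ℂ}
    (h : ∀ x, g (x + 1) = w * g x) (hw : w ^ n ≠ 1) : g = 0 := by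
  refine fin_geometric_eq_zero h ?_
  have h1 : ∀ j : ℕ, g (j : Fin n) = w ^ j * g 0 := by
    intro j
    induction j with
    | zero => simp
    | succ j ih => rw [Nat.cast_succ, h, ih, pow_succ]; ring
  have h2 := h1 n
  rw [Fin.natCast_self] at h2
  have h3 : (w ^ n - 1) * g 0 = 0 := by linear_combination -h2
  exact (mul_eq_zero.1 h3).resolve_left (sub_ne_zero.2 hw)

theorem pow_fin_val_add_one {n : ℕ} [NeZero n] (hn : 2 ≤ n) {w : ℂ} (hw : w ^ n = 1)
    (x : Fin n) : w ^ (x + 1).val = w * w ^ x.val := by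
  rw [fin_val_add_one_eq_ite hn]
  split_ifs with h
  · rw [← pow_succ', h, hw, pow_zero]
  · rw [pow_succ']

theorem mem_cutCycleEigenspace_empty {n : ℕ} [NeZero n] {c : ℂ} {g : Fin n → ℂ} :
    g ∈ cutCycleEigenspace ∅ c ↔ ∀ x, g (x + 1) + g (x - 1) = 2 * c * g x := by
  simp [mem_cutCycleEigenspace]

theorem pow_fin_val_mem {n : ℕ} [NeZero n] (hn : 2 ≤ n) {c w : ℂ} (hw0 : w ≠ 0)
    (hc : 2 * c = w + w⁻¹) (hw : w ^ n = 1) :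
    (fun x : Fin n => w ^ x.val) ∈ cutCycleEigenspace ∅ c := by
  rw [mem_cutCycleEigenspace_empty]
  intro x
  have h1 := pow_fin_val_add_one hn hw (x - 1)
  rw [sub_add_cancel] at h1
  have h2 : w ^ (x - 1).val = w⁻¹ * w ^ x.val := by
    rw [h1, ← mul_assoc, inv_mul_cancel₀ hw0, one_mul]
  simp only [pow_fin_val_add_one hn hw x, h2, hc]
  ring

/-- With `T` the shift, the equation factors as `(T - w⁻¹)(T - w) g = 0`, which leaves first-order
recurrences. -/
theorem cycle_eigenfunction_difference {n : ℕ} [NeZero n] {c w : ℂ} (hw0 : w ≠ 0)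
    (hc : 2 * c = w + w⁻¹) {g : Fin n → ℂ} (hg : g ∈ cutCycleEigenspace ∅ c) (x : Fin n) :
    g (x + 1 + 1) - w * g (x + 1) = w⁻¹ * (g (x + 1) - w * g x) := by
  have h := mem_cutCycleEigenspace_empty.1 hg (x + 1)
  rw [add_sub_cancel_right, hc] at h
  linear_combination h + g x * inv_mul_cancel₀ hw0

theorem finrank_cycle_eigenspace_of_pow_ne_one {n : ℕ} [NeZero n] {c z : ℂ} (hz0 : z ≠ 0)
    (hc : 2 * c = z + z⁻¹) (hz : z ^ n ≠ 1) :
    Module.finrank ℂ (cutCycleEigenspace (∅ : Finset (Fin n)) c) = 0 := by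
  have hbot : cutCycleEigenspace (∅ : Finset (Fin n)) c = ⊥ := by
    rw [Submodule.eq_bot_iff]
    intro g hg
    have hu : (fun x => g (x + 1) - z * g x) = 0 :=
      fin_geometric_eq_zero_of_pow_ne_one (w := z⁻¹)
        (fun x => cycle_eigenfunction_difference hz0 hc hg x) (by rwa [inv_pow, ne_eq, inv_eq_one])
    exact fin_geometric_eq_zero_of_pow_ne_one (fun x => sub_eq_zero.1 (congrFun hu x)) hz
  rw [hbot, finrank_bot]

theorem finrank_cycle_eigenspace_of_sq_ne_one {n : ℕ} [NeZero n] (hn : 2 ≤ n) {c z : ℂ}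
    (hz0 : z ≠ 0) (hc : 2 * c = z + z⁻¹) (hz : z ^ n = 1) (hz2 : z ^ 2 ≠ 1) :
    Module.finrank ℂ (cutCycleEigenspace (∅ : Finset (Fin n)) c) = 2 := by
  have hne : z - z⁻¹ ≠ 0 := by
    intro h
    apply hz2
    linear_combination z * h + mul_inv_cancel₀ hz0
  have hc' : 2 * c = z⁻¹ + z⁻¹⁻¹ := by rw [inv_inv, hc, add_comm]
  have hzi : z⁻¹ ^ n = 1 := by rw [inv_pow, hz, inv_one]
  rw [← Module.finrank_fin_fun (R := ℂ) (n := 2)]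
  let E : (Fin n → ℂ) →ₗ[ℂ] (Fin 2 → ℂ) := LinearMap.funLeft ℂ ℂ ![0, 1]
  let L := E.comp (cutCycleEigenspace (∅ : Finset (Fin n)) c).subtype
  have hL : ∀ g, L g = ![g.1 0, g.1 1] := by
    intro g
    funext i
    fin_cases i <;> rfl
  refine (LinearEquiv.ofBijective L ⟨?_, ?_⟩).finrank_eq
  · rw [← LinearMap.ker_eq_bot, LinearMap.ker_eq_bot']
    rintro ⟨g, hg⟩ h
    rw [hL] at h
    have g0 : g 0 = 0 := congrFun h 0
    have g1 : g 1 = 0 := congrFun h 1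
    have hu : (fun x => g (x + 1) - z * g x) = 0 :=
      fin_geometric_eq_zero (w := z⁻¹)
        (fun x => cycle_eigenfunction_difference hz0 hc hg x) (by simp [g0, g1])
    exact Subtype.ext (fin_geometric_eq_zero (fun x => sub_eq_zero.1 (congrFun hu x)) g0)
  · intro a
    let e₁ : cutCycleEigenspace (∅ : Finset (Fin n)) c := ⟨_, pow_fin_val_mem hn hz0 hc hz⟩
    let e₂ : cutCycleEigenspace (∅ : Finset (Fin n)) c :=
      ⟨_, pow_fin_val_mem hn (inv_ne_zero hz0) hc' hzi⟩
    -- The coefficients solve `α + β = a 0`, `α z + β z⁻¹ = a 1`.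
    refine ⟨((a 1 - z⁻¹ * a 0) / (z - z⁻¹)) • e₁ + ((z * a 0 - a 1) / (z - z⁻¹)) • e₂, ?_⟩
    rw [map_add, map_smul, map_smul, hL, hL]
    funext i
    fin_cases i
    · simp [e₁, e₂]
      rw [← add_div, div_eq_iff hne]
      ring
    · simp [e₁, e₂, Nat.mod_eq_of_lt (show 1 < n from hn)]
      rw [div_mul_eq_mul_div, div_mul_eq_mul_div, ← add_div, div_eq_iff hne]
      ring

theorem finrank_cycle_eigenspace_of_sq_eq_one {n : ℕ} [NeZero n] (hn : 2 ≤ n) {c z : ℂ}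
    (hc : 2 * c = z + z⁻¹) (hz : z ^ n = 1) (hz2 : z ^ 2 = 1) :
    Module.finrank ℂ (cutCycleEigenspace (∅ : Finset (Fin n)) c) = 1 := by
  have hz0 : z ≠ 0 := by
    rintro rfl
    norm_num at hz2
  have hzi : z⁻¹ = z := by
    exact inv_eq_of_mul_eq_one_left (by rw [← sq, hz2])
  let E : (Fin n → ℂ) →ₗ[ℂ] ℂ := LinearMap.proj 0
  let L := E.comp (cutCycleEigenspace (∅ : Finset (Fin n)) c).subtype
  rw [← Module.finrank_self ℂ]
  refine (LinearEquiv.ofBijective L ⟨?_, ?_⟩).finrank_eq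
  · rw [← LinearMap.ker_eq_bot, LinearMap.ker_eq_bot']
    rintro ⟨g, hg⟩ h
    have g0 : g 0 = 0 := h
    let u : Fin n → ℂ := fun x => g (x + 1) - z * g x
    have hu : ∀ x, u (x + 1) = z * u x := by
      intro x
      have h := cycle_eigenfunction_difference hz0 hc hg x
      rwa [hzi] at h
    -- Here `z = z⁻¹` is a double root, and the solution of type `x * z ^ x` must be excluded: `z ^
    -- x * u x` is constant, yet its sum telescopes to 0 around the cycle.
    have hconst : ∀ x, z ^ x.val * u x = u 0 := by
      refine fin_cyclic_induction 0 (by simp) fun y hy => ?_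
      rw [pow_fin_val_add_one hn hz, hu, ← hy]
      linear_combination z ^ y.val * u y * hz2
    have hsum : ∑ x, z ^ x.val * u x = 0 := by
      have h1 : ∀ x : Fin n, z ^ x.val * u x =
          z * (z ^ (x + 1).val * g (x + 1)) - z * (z ^ x.val * g x) := by
        intro x
        rw [pow_fin_val_add_one hn hz]
        simp only [u]
        linear_combination -(z ^ x.val * g (x + 1)) * hz2
      simp only [h1, Finset.sum_sub_distrib, ← Finset.mul_sum]
      have h2 := Equiv.sum_comp (Equiv.addRight (1 : Fin n)) (fun x => z ^ x.val * g x)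
      simp only [Equiv.coe_addRight] at h2
      rw [h2, sub_self]
    simp only [hconst, Finset.sum_const, Finset.card_univ, Fintype.card_fin, nsmul_eq_mul] at hsum
    have u0 : u 0 = 0 := (mul_eq_zero.1 hsum).resolve_left (Nat.cast_ne_zero.2 (NeZero.ne n))
    have hu0 : u = 0 := fin_geometric_eq_zero hu u0
    exact Subtype.ext (fin_geometric_eq_zero (fun x => sub_eq_zero.1 (congrFun hu0 x)) g0)
  · intro a
    refine ⟨a • ⟨_, pow_fin_val_mem hn hz0 hc hz⟩, ?_⟩
    rw [map_smul]
    change a * z ^ (0 : Fin n).val = a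
    simp

end

end

/-! ### Multiplicities at cosine values -/

noncomputable section

theorem finrank_eigenspace_cycleEdgeLamplighter (N : ℕ) (c : ℂ) :
    Module.finrank ℂ ((cycleEdgeLamplighter (N + 3)).eigenspace c) =
      (N + 3) * ∑ d ∈ Finset.range (N + 3),
        (open Classical in if chebyshevU ((d : ℤ) + 1) c = 0 then 2 ^ (N + 1 - d) else 0) +
        Module.finrank ℂ (cutCycleEigenspace (∅ : Finset (Fin (N + 3))) c) :=
  (finrank_eigenspace_eq_sum N c).trans (sum_finrank_cutCycleEigenspace (by omega) c)

theorem chebyshevU_one_ne_zero (d : ℕ) : chebyshevU ((d : ℤ) + 1) 1 ≠ 0 := by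
  rw [chebyshevU, Polynomial.Chebyshev.U_eval_one]
  exact_mod_cast Nat.succ_ne_zero (d + 1)

theorem chebyshevU_eval_neg_one_ne_zero (d : ℕ) : chebyshevU ((d : ℤ) + 1) (-1) ≠ 0 := by
  rw [chebyshevU, Polynomial.Chebyshev.U_eval_neg_one]
  refine mul_ne_zero ?_ (by exact_mod_cast Nat.succ_ne_zero (d + 1))
  simp

theorem finrank_eigenspace_one (N : ℕ) :
    Module.finrank ℂ ((cycleEdgeLamplighter (N + 3)).eigenspace 1) = 1 := by
  rw [finrank_eigenspace_cycleEdgeLamplighter,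
    finrank_cycle_eigenspace_of_sq_eq_one (z := 1) (by omega) (by norm_num) (one_pow _) (one_pow _)]
  simp [chebyshevU_one_ne_zero]

theorem finrank_eigenspace_neg_one_of_even (N : ℕ) (h : Even (N + 3)) :
    Module.finrank ℂ ((cycleEdgeLamplighter (N + 3)).eigenspace (-1)) = 1 := by
  rw [finrank_eigenspace_cycleEdgeLamplighter,
    finrank_cycle_eigenspace_of_sq_eq_one (z := -1) (by omega) (by norm_num) h.neg_one_pow
      (by norm_num)]
  simp [chebyshevU_eval_neg_one_ne_zero]

theorem finrank_eigenspace_neg_one_of_odd (N : ℕ) (h : Odd (N + 3)) :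
    Module.finrank ℂ ((cycleEdgeLamplighter (N + 3)).eigenspace (-1)) = 0 := by
  rw [finrank_eigenspace_cycleEdgeLamplighter,
    finrank_cycle_eigenspace_of_pow_ne_one (z := -1) (by norm_num) (by norm_num)
      (by rw [h.neg_one_pow]; norm_num)]
  simp [chebyshevU_eval_neg_one_ne_zero]

theorem sin_rational_mul_pi_eq_zero_iff {k : ℕ} (hk : k ≠ 0) (a : ℕ) :
    Real.sin (a * Real.pi / k) = 0 ↔ k ∣ a := by
  have hk' : (k : ℝ) ≠ 0 := Nat.cast_ne_zero.2 hk
  rw [Real.sin_eq_zero_iff]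
  constructor
  · rintro ⟨m, hm⟩
    have h1 : ((a : ℤ) : ℝ) = ((k * m : ℤ) : ℝ) := by
      apply mul_right_cancel₀ Real.pi_ne_zero
      push_cast
      field_simp at hm
      linear_combination -Real.pi * hm
    exact Int.natCast_dvd_natCast.1 ⟨m, Int.cast_injective h1⟩
  · rintro ⟨m, rfl⟩
    refine ⟨m, ?_⟩
    push_cast
    field_simp

/-- From `U_{d+1}(cos θ) sin θ = sin ((d + 2) θ)` with `sin θ ≠ 0`; coprimality removes `h` from the
divisibility. -/
theorem chebyshevU_cos_eq_zero_iff {k h : ℕ} (h1 : 1 ≤ h) (hk : h < k) (hc : Nat.Coprime h k)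
    (d : ℕ) : chebyshevU ((d : ℤ) + 1) (Real.cos (h * Real.pi / k) : ℂ) = 0 ↔ k ∣ d + 2 := by
  have hk0 : k ≠ 0 := by omega
  have hs : Real.sin (h * Real.pi / k) ≠ 0 := by
    rw [ne_eq, sin_rational_mul_pi_eq_zero_iff hk0]
    exact fun hd => absurd (Nat.le_of_dvd h1 hd) (by omega)
  have hU := Polynomial.Chebyshev.U_real_cos (h * Real.pi / k) ((d : ℤ) + 1)
  rw [chebyshevU, ← Polynomial.Chebyshev.complex_ofReal_eval_U, Complex.ofReal_eq_zero,
    ← mul_eq_zero_iff_right hs, hU]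
  have e : (((d : ℤ) + 1 : ℤ) + 1 : ℝ) * (h * Real.pi / k) = ((d + 2) * h : ℕ) * Real.pi / k := by
    push_cast
    ring
  rw [e, sin_rational_mul_pi_eq_zero_iff hk0]
  exact hc.symm.dvd_mul_right

theorem finrank_cycle_eigenspace_cos {n k h : ℕ} [NeZero n] (hn : 2 ≤ n) (h1 : 1 ≤ h)
    (hk : h < k) :
    Module.finrank ℂ (cutCycleEigenspace (∅ : Finset (Fin n)) (Real.cos (h * Real.pi / k) : ℂ)) =
      if 2 * k ∣ h * n then 2 else 0 := by
  have hk0 : (k : ℂ) ≠ 0 := Nat.cast_ne_zero.2 (by omega)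
  let z := Complex.exp ((h * Real.pi / k : ℂ) * Complex.I)
  have hz0 : z ≠ 0 := Complex.exp_ne_zero _
  have hc : 2 * (Real.cos (h * Real.pi / k) : ℂ) = z + z⁻¹ := by
    simp only [z]
    rw [← Complex.exp_neg, ← neg_mul]
    push_cast
    exact Complex.two_cos _
  have hpow : ∀ a : ℕ, z ^ a = 1 ↔ 2 * k ∣ h * a := by
    intro a
    simp only [z]
    rw [← Complex.exp_nat_mul, Complex.exp_eq_one_iff]
    have key : ∀ m : ℤ, ((a : ℂ) * ((h * Real.pi / k : ℂ) * Complex.I) =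
        m * (2 * Real.pi * Complex.I)) ↔ ((h * a : ℕ) : ℤ) = (2 * k : ℕ) * m := by
      intro m
      rw [← Int.cast_inj (α := ℂ)]
      push_cast
      constructor
      · intro hm
        field_simp at hm
        linear_combination hm
      · intro hm
        field_simp
        linear_combination hm
    rw [exists_congr key]
    exact Int.natCast_dvd_natCast
  have hz2 : z ^ 2 ≠ 1 := by
    rw [ne_eq, hpow, mul_comm h 2, Nat.mul_dvd_mul_iff_left (by norm_num)]
    exact fun hd => absurd (Nat.le_of_dvd h1 hd) (by omega)
  split_ifs with hd
  · exact finrank_cycle_eigenspace_of_sq_ne_one hn hz0 hc ((hpow n).2 hd) hz2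
  · exact finrank_cycle_eigenspace_of_pow_ne_one hz0 hc (fun h => hd ((hpow n).1 h))

/-- Raising `M` by one doubles the sum and adds 1 when `k ∣ M + 2`, exactly when the remainder of `M
+ 1` wraps from `k - 1` to 0. -/
theorem sum_two_pow_multiples {k : ℕ} (hk : 2 ≤ k) (M : ℕ) :
    (2 ^ k - 1 : ℝ) * (∑ d ∈ Finset.range M, if k ∣ d + 2 then (2 : ℝ) ^ (M - 1 - d) else 0) =
      2 ^ (M + 1) - 2 ^ ((M + 1) % k) := by
  induction M with
  | zero => simp [Nat.mod_eq_of_lt hk]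
  | succ M ih =>
    have h2 : ∑ d ∈ Finset.range M, (if k ∣ d + 2 then (2 : ℝ) ^ (M + 1 - 1 - d) else 0) =
        2 * ∑ d ∈ Finset.range M, if k ∣ d + 2 then (2 : ℝ) ^ (M - 1 - d) else 0 := by
      rw [Finset.mul_sum]
      refine Finset.sum_congr rfl fun d hd => ?_
      rw [Finset.mem_range] at hd
      rw [show M + 1 - 1 - d = (M - 1 - d) + 1 by omega, pow_succ]
      split_ifs <;> ring
    rw [Finset.sum_range_succ, h2, mul_add, mul_left_comm, ih]
    have hmod : (M + 1) % k < k := Nat.mod_lt _ (by omega)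
    have hdm := Nat.div_add_mod (M + 1) k
    by_cases hd : k ∣ M + 2
    · have h0 : (M + 1 + 1) % k = 0 := Nat.mod_eq_zero_of_dvd hd
      have h1 : (M + 1) % k + 1 = k := by
        by_contra hne
        rw [Nat.add_mod, Nat.mod_eq_of_lt (show 1 < k by omega), Nat.mod_eq_of_lt (by omega)] at h0
        omega
      rw [if_pos hd, h0, show M + 1 - 1 - M = 0 by omega]
      have h3 : (2 : ℝ) ^ k = 2 ^ ((M + 1) % k) * 2 := by rw [← pow_succ, h1]
      rw [h3]
      ring
    · have h1 : (M + 1) % k + 1 ≠ k := by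
        intro hne
        refine hd ⟨(M + 1) / k + 1, ?_⟩
        rw [mul_add]
        omega
      have h0 : (M + 1 + 1) % k = (M + 1) % k + 1 := by
        rw [Nat.add_mod, Nat.mod_eq_of_lt (show 1 < k by omega), Nat.mod_eq_of_lt (by omega)]
      rw [if_neg hd, h0]
      ring

theorem finrank_eigenspace_cos (N : ℕ) {k h : ℕ} (h1 : 1 ≤ h) (hk : h < k)
    (hc : Nat.Coprime h k) :
    (Module.finrank ℂ ((cycleEdgeLamplighter (N + 3)).eigenspace
      (Real.cos (h * Real.pi / k) : ℂ)) : ℝ) =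
      (N + 3 : ℕ) * ((2 ^ (N + 3) - 2 ^ ((N + 3) % k)) / (2 ^ k - 1) +
        if k ∣ N + 4 then 1 else 0) + if 2 * k ∣ h * (N + 3) then 2 else 0 := by
  rw [finrank_eigenspace_cycleEdgeLamplighter, finrank_cycle_eigenspace_cos (by omega) h1 hk]
  simp only [chebyshevU_cos_eq_zero_iff h1 hk hc]
  have hne : (2 ^ k - 1 : ℝ) ≠ 0 :=
    sub_ne_zero.2 (one_lt_pow₀ (by norm_num : (1 : ℝ) < 2) (by omega)).ne'
  have hs := sum_two_pow_multiples (show 2 ≤ k by omega) (N + 2)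
  rw [mul_comm, ← eq_div_iff hne] at hs
  -- The last term, `d = n - 1`, falls outside the geometric pattern: its exponent is truncated to
  -- 0. It yields the summand for `k ∣ n + 1`.
  rw [Finset.sum_range_succ]
  push_cast
  rw [show N - (N + 1) = 0 by omega, pow_zero]
  simp only [show N + 2 - 1 = N + 1 by omega, show N + 2 + 1 = N + 3 by omega] at hs
  rw [hs]

theorem finrank_eigenspace_cos_cases (N : ℕ) {k h q r : ℕ} (h1 : 1 ≤ h) (hk : h < k)
    (hc : Nat.Coprime h k) (hqr : N + 3 + 1 = k * q + r) (hr : r < k) :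
    let m : ℝ := Module.finrank ℂ ((cycleEdgeLamplighter (N + 3)).eigenspace
      (Real.cos (h * Real.pi / k) : ℂ))
    (2 ≤ r → m = (N + 3 : ℕ) * ((2 ^ (N + 3) - 2 ^ (r - 1)) / (2 ^ k - 1))) ∧
    (r = 1 → Odd (h * q) → m = (N + 3 : ℕ) * ((2 ^ (N + 3) - 1) / (2 ^ k - 1))) ∧
    (r = 1 → Even (h * q) → m = (N + 3 : ℕ) * ((2 ^ (N + 3) - 1) / (2 ^ k - 1)) + 2) ∧
    (r = 0 → m = (N + 3 : ℕ) * ((2 ^ (N + 3) + 2 ^ (k - 1) - 1) / (2 ^ k - 1))) := by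
  intro m
  have hm : m = _ := finrank_eigenspace_cos N h1 hk hc
  rw [hm]
  have hne : (2 ^ k - 1 : ℝ) ≠ 0 :=
    sub_ne_zero.2 (one_lt_pow₀ (by norm_num : (1 : ℝ) < 2) (by omega)).ne'
  have hdvd : k ∣ N + 4 ↔ r = 0 := by
    rw [show N + 4 = k * q + r by omega, Nat.dvd_add_right (dvd_mul_right k q)]
    exact ⟨fun h => Nat.eq_zero_of_dvd_of_lt h hr, fun h => h ▸ dvd_zero k⟩
  -- `r` is the remainder of `n + 1`, whereas the sum involves that of `n`.
  have hmod : 1 ≤ r → (N + 3) % k = r - 1 := by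
    intro h
    rw [show N + 3 = r - 1 + k * q by omega, Nat.add_mul_mod_self_left,
      Nat.mod_eq_of_lt (by omega)]
  have hmod0 : r = 0 → (N + 3) % k = k - 1 := by
    intro h
    obtain ⟨p, rfl⟩ : ∃ p, q = p + 1 := ⟨q - 1, by
      rcases q with _ | q
      · omega
      · rfl⟩
    rw [mul_add] at hqr
    rw [show N + 3 = k - 1 + k * p by omega, Nat.add_mul_mod_self_left,
      Nat.mod_eq_of_lt (by omega)]
  have hcyc : r ≠ 1 → ¬ 2 * k ∣ h * (N + 3) := by
    intro hr1 hd
    have hkn : k ∣ N + 3 := hc.symm.dvd_of_dvd_mul_left ((dvd_mul_left k 2).trans hd)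
    have h0 := Nat.mod_eq_zero_of_dvd hkn
    rcases Nat.eq_zero_or_pos r with h | h
    · have := hmod0 h
      omega
    · have := hmod h
      omega
  -- Here `n = q * k`, so `2k ∣ h * n` reduces to `2 ∣ h * q`.
  have hcyc1 : r = 1 → (2 * k ∣ h * (N + 3) ↔ Even (h * q)) := by
    intro hr1
    rw [show N + 3 = q * k by rw [mul_comm]; omega, ← mul_assoc,
      Nat.mul_dvd_mul_iff_right (by omega), even_iff_two_dvd]
  refine ⟨fun h => ?_, fun h ho => ?_, fun h he => ?_, fun h => ?_⟩
  · rw [if_neg (by rw [hdvd]; omega), if_neg (hcyc (by omega)), hmod (by omega), add_zero, add_zero]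
  · rw [if_neg (by rw [hdvd]; omega), if_neg (by rwa [hcyc1 h, Nat.not_even_iff_odd]),
      hmod (by omega), h, add_zero, add_zero]
    norm_num
  · rw [if_neg (by rw [hdvd]; omega), if_pos ((hcyc1 h).2 he), hmod (by omega), h, add_zero]
    norm_num
  · rw [if_pos (hdvd.2 h), if_neg (hcyc (by omega)), hmod0 h, add_zero]
    congr 1
    have h3 : (2 : ℝ) ^ k = 2 ^ (k - 1) * 2 := by rw [← pow_succ, Nat.sub_add_cancel (by omega)]
    rw [div_add_one hne, h3]
    congr 1
    ring

/-! ### The spectrum -/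

theorem mem_spectrum_iff_finrank_ne_zero (N : ℕ) (c : ℂ) :
    c ∈ spectrum ℂ (cycleEdgeLamplighter (N + 3)) ↔
      Module.finrank ℂ ((cycleEdgeLamplighter (N + 3)).eigenspace c) ≠ 0 := by
  rw [← Module.End.hasEigenvalue_iff_mem_spectrum, Module.End.hasEigenvalue_iff, ne_eq, ne_eq,
    Submodule.finrank_eq_zero]

theorem mem_spectrum_of_chebyshevU_eq_zero {N d : ℕ} (hd : d < N + 3) {c : ℂ}
    (h : chebyshevU ((d : ℤ) + 1) c = 0) : c ∈ spectrum ℂ (cycleEdgeLamplighter (N + 3)) := by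
  classical
  rw [mem_spectrum_iff_finrank_ne_zero, finrank_eigenspace_cycleEdgeLamplighter]
  have h1 : 0 < ∑ d ∈ Finset.range (N + 3),
      (if chebyshevU ((d : ℤ) + 1) c = 0 then 2 ^ (N + 1 - d) else 0) :=
    Finset.sum_pos' (fun _ _ => Nat.zero_le _) ⟨d, Finset.mem_range.2 hd, by
      rw [if_pos h]
      positivity⟩
  have h2 : 0 < (N + 3) * ∑ d ∈ Finset.range (N + 3),
      (if chebyshevU ((d : ℤ) + 1) c = 0 then 2 ^ (N + 1 - d) else 0) :=
    Nat.mul_pos (by omega) h1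
  omega

/-- Periodicity and reflection bring the numerator into `[0, M]`. The ends give `±1`; otherwise, in
lowest terms, denominator 2 gives 0 and larger ones give `cosineValues`. -/
theorem cos_rational_mul_pi_mem {n M : ℕ} (hM : 1 ≤ M) (hMn : M ≤ n + 1) (m : ℤ) :
    Real.cos (m * Real.pi / M) ∈ ({1} ∪ {0} ∪ {-1} ∪ cosineValues n : Set ℝ) := by
  have hM0 : (M : ℝ) ≠ 0 := Nat.cast_ne_zero.2 (by omega)
  have key : ∀ j : ℕ, j ≤ M →
      Real.cos (j * Real.pi / M) ∈ ({1} ∪ {0} ∪ {-1} ∪ cosineValues n : Set ℝ) := by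
    intro j hj
    rcases Nat.eq_zero_or_pos j with rfl | hj0
    · simp
    rcases hj.eq_or_lt with rfl | hjM
    · simp [mul_div_cancel_left₀ _ hM0]
    obtain ⟨g, h, k, hg, hcop, rfl, rfl⟩ := Nat.exists_coprime' (Nat.gcd_pos_of_pos_left M hj0)
    have hhk : h < k := lt_of_mul_lt_mul_right hjM (Nat.zero_le _)
    have hh : 1 ≤ h := Nat.pos_of_mul_pos_right hj0
    have hkM : k ≤ k * g := Nat.le_mul_of_pos_right _ hg
    have hg0 : (g : ℝ) ≠ 0 := Nat.cast_ne_zero.2 (by omega)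
    have e : ((h * g : ℕ) : ℝ) * Real.pi / (k * g : ℕ) = h * Real.pi / k := by
      push_cast
      rw [mul_right_comm, mul_div_mul_right _ _ hg0]
    rw [e]
    rcases (show 2 ≤ k by omega).eq_or_lt with rfl | hk
    · obtain rfl : h = 1 := by omega
      simp
    · exact Or.inr ⟨k, h, hk, hkM.trans hMn, hh, hhk, hcop, rfl⟩
  have hper : ∀ a b : ℤ,
      Real.cos ((a + 2 * M * b : ℤ) * Real.pi / M) = Real.cos (a * Real.pi / M) := by
    intro a b
    rw [← Real.cos_add_int_mul_two_pi (a * Real.pi / M) b]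
    congr 1
    push_cast
    field_simp
  have hpos : (0 : ℤ) < 2 * M := by omega
  have hj0 := Int.emod_nonneg m hpos.ne'
  have hj1 := Int.emod_lt_of_pos m hpos
  have hm := Int.emod_add_mul_ediv m (2 * M)
  rw [← hm, hper]
  generalize m % (2 * M) = j at *
  rcases le_or_gt j M with hle | hgt
  · lift j to ℕ using hj0
    exact_mod_cast key j (by exact_mod_cast hle)
  · have h2 := hper (-j) 1
    have h3 := key (2 * M - j).toNat (by omega)
    have h4 : (((2 * M - j).toNat : ℕ) : ℝ) = ((-j + 2 * M * 1 : ℤ) : ℝ) := by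
      rw [← Int.cast_natCast, Int.toNat_of_nonneg (by omega)]
      congr 1
      ring
    rw [h4, h2, Int.cast_neg, neg_mul, neg_div, Real.cos_neg] at h3
    exact h3

theorem spectrum_subset (N : ℕ) : spectrum ℂ (cycleEdgeLamplighter (N + 3)) ⊆
    (fun c : ℝ => (c : ℂ)) '' ({1} ∪ {0} ∪ {-1} ∪ cosineValues (N + 3)) := by
  classical
  intro c hc
  rw [mem_spectrum_iff_finrank_ne_zero, finrank_eigenspace_cycleEdgeLamplighter] at hc
  -- `θ` is complex a priori; either source of eigenvalues, `z ^ n = 1` or `sin ((d + 2) θ) = 0`,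
  -- makes it a rational multiple of `π` with denominator at most `n + 1`.
  obtain ⟨θ, rfl⟩ := Complex.cos_surjective c
  by_cases hz : Complex.exp (θ * Complex.I) ^ (N + 3) = 1
  · rw [← Complex.exp_nat_mul, Complex.exp_eq_one_iff] at hz
    obtain ⟨m, hm⟩ := hz
    refine ⟨_, cos_rational_mul_pi_mem (M := N + 3) (by omega) (by omega) (2 * m), ?_⟩
    beta_reduce
    rw [Complex.ofReal_cos]
    congr 1
    have h0 : ((N + 3 : ℕ) : ℂ) ≠ 0 := Nat.cast_ne_zero.2 (by omega)
    have hm' : ((N + 3 : ℕ) : ℂ) * θ = m * (2 * Real.pi) :=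
      mul_right_cancel₀ Complex.I_ne_zero (by linear_combination hm)
    rw [Complex.ofReal_div, Complex.ofReal_natCast, div_eq_iff h0]
    push_cast at hm' ⊢
    linear_combination -hm'
  · rw [finrank_cycle_eigenspace_of_pow_ne_one (Complex.exp_ne_zero (θ * Complex.I))
      (by rw [← Complex.exp_neg, ← neg_mul]; exact Complex.two_cos _) hz, add_zero] at hc
    obtain ⟨d, hd, hd0⟩ := Finset.exists_ne_zero_of_sum_ne_zero (right_ne_zero_of_mul hc)
    have hU : chebyshevU ((d : ℤ) + 1) (Complex.cos θ) = 0 := by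
      by_contra h
      exact hd0 (if_neg h)
    rw [Finset.mem_range] at hd
    have hsin : Complex.sin θ ≠ 0 := by
      intro h
      have h1 := Complex.sin_sq_add_cos_sq θ
      rw [h, zero_pow two_ne_zero, zero_add, sq_eq_one_iff] at h1
      rcases h1 with h1 | h1
      · exact chebyshevU_one_ne_zero d (h1 ▸ hU)
      · exact chebyshevU_eval_neg_one_ne_zero d (h1 ▸ hU)
    have hs := Polynomial.Chebyshev.U_complex_cos θ ((d : ℤ) + 1)
    rw [chebyshevU] at hU
    rw [hU, zero_mul, eq_comm, Complex.sin_eq_zero_iff] at hs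
    obtain ⟨m, hm⟩ := hs
    refine ⟨_, cos_rational_mul_pi_mem (M := d + 2) (by omega) (by omega) m, ?_⟩
    beta_reduce
    rw [Complex.ofReal_cos]
    congr 1
    rw [Complex.ofReal_div, Complex.ofReal_natCast,
      div_eq_iff (Nat.cast_ne_zero.2 (by omega))]
    push_cast at hm ⊢
    linear_combination -hm

theorem cosineValues_subset_spectrum (N : ℕ) {c : ℝ} (hc : c ∈ cosineValues (N + 3)) :
    (c : ℂ) ∈ spectrum ℂ (cycleEdgeLamplighter (N + 3)) := by
  obtain ⟨k, h, hk, hkn, h1, hhk, hcop, rfl⟩ := hc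
  refine mem_spectrum_of_chebyshevU_eq_zero (d := k - 2) (by omega)
    ((chebyshevU_cos_eq_zero_iff h1 hhk hcop _).2 ?_)
  rw [Nat.sub_add_cancel (by omega)]

theorem one_or_zero_mem_spectrum (N : ℕ) {c : ℝ} (hc : c ∈ ({1} ∪ {0} : Set ℝ)) :
    (c : ℂ) ∈ spectrum ℂ (cycleEdgeLamplighter (N + 3)) := by
  rcases hc with rfl | rfl
  · rw [mem_spectrum_iff_finrank_ne_zero, Complex.ofReal_one, finrank_eigenspace_one]
    exact one_ne_zero
  · refine mem_spectrum_of_chebyshevU_eq_zero (d := 0) (by omega) ?_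
    simp [chebyshevU]

theorem spectrum_of_odd (N : ℕ) (h : Odd (N + 3)) : spectrum ℂ (cycleEdgeLamplighter (N + 3)) =
    (fun c : ℝ => (c : ℂ)) '' ({1} ∪ {0} ∪ cosineValues (N + 3)) := by
  refine subset_antisymm (fun c hc => ?_) ?_
  · obtain ⟨x, hx, rfl⟩ := spectrum_subset N hc
    refine ⟨x, ?_, rfl⟩
    rcases hx with (hx | rfl) | hx
    · exact Or.inl hx
    · beta_reduce at hc
      rw [mem_spectrum_iff_finrank_ne_zero, Complex.ofReal_neg, Complex.ofReal_one] at hc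
      exact absurd (finrank_eigenspace_neg_one_of_odd N h) hc
    · exact Or.inr hx
  · rintro _ ⟨x, hx | hx, rfl⟩
    · exact one_or_zero_mem_spectrum N hx
    · exact cosineValues_subset_spectrum N hx

theorem spectrum_of_even (N : ℕ) (h : Even (N + 3)) : spectrum ℂ (cycleEdgeLamplighter (N + 3)) =
    (fun c : ℝ => (c : ℂ)) '' ({1} ∪ {0} ∪ {-1} ∪ cosineValues (N + 3)) := by
  refine subset_antisymm (spectrum_subset N) ?_
  rintro _ ⟨x, (hx | rfl) | hx, rfl⟩
  · exact one_or_zero_mem_spectrum N hx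
  · beta_reduce
    rw [mem_spectrum_iff_finrank_ne_zero, Complex.ofReal_neg, Complex.ofReal_one,
      finrank_eigenspace_neg_one_of_even N h]
    exact one_ne_zero
  · exact cosineValues_subset_spectrum N hx

end

theorem mainTheorem1 (n : ℕ) (hn : 3 ≤ n) :
    -- the spectrum
    (Odd n → spectrum ℂ (cycleEdgeLamplighter n) =
      (fun c : ℝ => (c : ℂ)) '' ({1} ∪ {0} ∪ cosineValues n)) ∧
    (Even n → spectrum ℂ (cycleEdgeLamplighter n) =
      (fun c : ℝ => (c : ℂ)) '' ({1} ∪ {0} ∪ {-1} ∪ cosineValues n)) ∧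
    -- the multiplicities of the eigenvalues `cos (h π / k)`, where `n + 1 = k q + r`
    (∀ k h q r : ℕ, 3 ≤ k → k ≤ n + 1 → 1 ≤ h → h < k → Nat.Coprime h k →
      n + 1 = k * q + r → r < k →
      (2 ≤ r → (eigenMultiplicity n (Real.cos (h * Real.pi / k)) : ℝ) =
        n * ((2 ^ n - 2 ^ (r - 1)) / (2 ^ k - 1))) ∧
      (r = 1 → Odd (h * q) → (eigenMultiplicity n (Real.cos (h * Real.pi / k)) : ℝ) =
        n * ((2 ^ n - 1) / (2 ^ k - 1))) ∧
      (r = 1 → Even (h * q) → (eigenMultiplicity n (Real.cos (h * Real.pi / k)) : ℝ) =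
        n * ((2 ^ n - 1) / (2 ^ k - 1)) + 2) ∧
      (r = 0 → (eigenMultiplicity n (Real.cos (h * Real.pi / k)) : ℝ) =
        n * ((2 ^ n + 2 ^ (k - 1) - 1) / (2 ^ k - 1)))) ∧
    -- the multiplicities of `1` and `-1`
    eigenMultiplicity n 1 = 1 ∧
    (Even n → eigenMultiplicity n (-1) = 1) ∧
    (Odd n → eigenMultiplicity n (-1) = 0) ∧
    -- the multiplicity of `0`
    (Odd n → (eigenMultiplicity n 0 : ℝ) = n / 3 * 2 ^ n + n / 3) ∧
    (n % 4 = 2 → (eigenMultiplicity n 0 : ℝ) = n / 3 * 2 ^ n - n / 3) ∧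
    (n % 4 = 0 → (eigenMultiplicity n 0 : ℝ) = n / 3 * 2 ^ n - n / 3 + 2) := by
  obtain ⟨N, rfl⟩ : ∃ N, n = N + 3 := ⟨n - 3, by omega⟩
  -- Writing 0 as `cos (π / 2)` makes the case formula apply with `k = 2`; for even `n` the parity
  -- of `q = n / 2` separates the classes modulo 4.
  have hzero : eigenMultiplicity (N + 3) 0 = Module.finrank ℂ
      ((cycleEdgeLamplighter (N + 3)).eigenspace (Real.cos ((1 : ℕ) * Real.pi / (2 : ℕ)) : ℂ)) := by
    rw [eigenMultiplicity, show Real.cos ((1 : ℕ) * Real.pi / (2 : ℕ)) = 0 by simp]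
  refine ⟨spectrum_of_odd N, spectrum_of_even N, ?_, ?_, fun h => ?_, fun h => ?_, fun h => ?_,
    fun h => ?_, fun h => ?_⟩
  · intro k h q r hk _ h1 hhk hcop hqr hr
    exact finrank_eigenspace_cos_cases N h1 hhk hcop hqr hr
  · rw [eigenMultiplicity, Complex.ofReal_one, finrank_eigenspace_one]
  · rw [eigenMultiplicity, Complex.ofReal_neg, Complex.ofReal_one,
      finrank_eigenspace_neg_one_of_even N h]
  · rw [eigenMultiplicity, Complex.ofReal_neg, Complex.ofReal_one,
      finrank_eigenspace_neg_one_of_odd N h]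
  · obtain ⟨q, hq⟩ := h
    rw [hzero, (finrank_eigenspace_cos_cases N (q := q + 1) (r := 0) le_rfl one_lt_two
      (Nat.coprime_one_left 2) (by omega) (by omega)).2.2.2 rfl]
    ring
  · rw [hzero, (finrank_eigenspace_cos_cases N (q := (N + 3) / 2) (r := 1) le_rfl one_lt_two
      (Nat.coprime_one_left 2) (by omega) (by omega)).2.1 rfl (by rw [Nat.odd_iff]; omega)]
    ring
  · rw [hzero, (finrank_eigenspace_cos_cases N (q := (N + 3) / 2) (r := 1) le_rfl one_lt_two
      (Nat.coprime_one_left 2) (by omega) (by omega)).2.2.1 rfl (by rw [Nat.even_iff]; omega)]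
    ring
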